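/- For $f\in L^2(\mathbb{R})$ (complex-valued) let $$\mathcal{G}f(x,\omega)=2^{1/4}\int_{\mathbb{R}} f(t)\,e^{-\pi(t-x)^2}e^{-2\pi i t\omega}\,dt,\quad (x,\omega)\in\mathbb{R}^2,$$ be its Gabor transform and $$\mathcal{B}f(z)=2^{1/4}\int_{\mathbb{R}} f(t)\,e^{2\pi tz-\pi t^2-\frac{\pi}{2}z^2}\,dt,\quad z\in\mathbb{C},$$ its Bargmann transform. Let $\varphi(t)=2^{1/4}e^{-\pi t^2}$ be the normalised Gaussian, and let the Fock space $\mathcal{F}^2(\mathbb{C})$ be the set of entire functions $F$ with $\int_{\mathbb{C}}|F(z)|^2e^{-\pi|z|^2}\,dz<\infty$. For $\Lambda\subset\mathbb{R}^2$ let $\mathfrak{C}(\Lambda)$ be the set of all $f\in L^2(\mathbb{R})$ for which there is $g\in L^2(\mathbb{R})$ such that $|\mathcal{G}f|=|\mathcal{G}g|$ on $\Lambda$ but $f\neq e^{i\alpha}g$ for every $\alpha\in\mathbb{R}$. Let $0<a<1$. Then: 1. If $f\in L^2(\mathbb{R})$ satisfies $|\mathcal{G}f(x,\omega)|^2=|\mathcal{G}\varphi(x,\omega)|^2$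 for all $(x,\omega)\in a\mathbb{Z}^2$, then there is $\alpha\in\mathbb{R}$ with $f=e^{i\alpha}\varphi$. 2. Consequently $\varphi\notin\mathfrak{C}(a\mathbb{Z}^2)$, and in particular $\mathfrak{C}(a\mathbb{Z}^2)\neq L^2(\mathbb{R})$. 3. If $F\in\mathcal{F}^2(\mathbb{C})$ satisfies $|F(z)|=1$ for all $z\in a\mathbb{Z}+ia\mathbb{Z}$, then there is $\alpha\in\mathbb{R}$ with $F(z)=e^{i\alpha}$ for all $z\in\mathbb{C}$. 4. Statements 1 and 3 correspond to each other under the Bargmann transform: $\mathcal{B}$ is a bijection from $L^2(\mathbb{R})$ onto $\mathcal{F}^2(\mathbb{C})$, and for every $f\in L^2(\mathbb{R})$ one has $|\mathcal{G}f|^2=|\mathcal{G}\varphi|^2$ on $a\mathbb{Z}^2$ if and only if $|\mathcal{B}f|=1$ on $a\mathbb{Z}+ia\mathbb{Z}$, and, for every $\alpha\in\mathbb{R}$, $f=e^{i\alpha}\varphi$ if and only if $\mathcal{B}f(z)=e^{i\alpha}$ for all $z\in\mathbb{C}$. -/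

import Mathlib

open MeasureTheory

/-- The Hilbert space `L²(ℝ)` of complex-valued square-integrable signals. -/
abbrev L2R : Type := Lp ℂ 2 (volume : Measure ℝ)

/-- The Gabor transform
`𝒢f(x, ω) = 2^{1/4} ∫ f(t) e^{-π(t-x)²} e^{-2πitω} dt`. -/
noncomputable def gabor (f : L2R) (p : ℝ × ℝ) : ℂ :=
  (((2 : ℝ) ^ (1 / 4 : ℝ) : ℝ) : ℂ) *
    ∫ t : ℝ, f t * Complex.exp (-(Real.pi : ℂ) * ((t : ℂ) - p.1) ^ 2) *
      Complex.exp (-2 * Real.pi * Complex.I * t * p.2)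

/-- The normalised Gaussian `φ(t) = 2^{1/4} e^{-πt²}` as a function. -/
noncomputable def gaussianFun (t : ℝ) : ℂ :=
  (((2 : ℝ) ^ (1 / 4 : ℝ) * Real.exp (-Real.pi * t ^ 2) : ℝ) : ℂ)

theorem memLp_gaussianFun : MemLp gaussianFun 2 (volume : Measure ℝ) := by
  have hc : Continuous gaussianFun := by unfold gaussianFun; fun_prop
  rw [memLp_two_iff_integrable_sq_norm hc.aestronglyMeasurable]
  have h := (integrable_exp_neg_mul_sq (b := 2 * Real.pi) (by positivity)).const_mul
    (((2 : ℝ) ^ (1 / 4 : ℝ)) ^ 2)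
  refine h.congr (Filter.Eventually.of_forall fun t => ?_)
  simp only [gaussianFun, Complex.norm_real, Real.norm_eq_abs, sq_abs, mul_pow]
  rw [← Real.exp_nat_mul]
  congr 2
  push_cast
  ring

/-- The normalised Gaussian as an element of `L²(ℝ)`. -/
noncomputable def gaussian : L2R := memLp_gaussianFun.toLp gaussianFun

/-- `f ∼ g`: the signals agree up to a global phase, `f = e^{iα} g` for some real `α`. -/
def AgreeUpToGlobalPhase (f g : L2R) : Prop :=
  ∃ α : ℝ, f = Complex.exp (Complex.I * α) • g

/-- The set of counterexamples to uniqueness in Gabor phase retrieval on `Λ`. -/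
def counterexamples (Λ : Set (ℝ × ℝ)) : Set L2R :=
  {f | ∃ g : L2R, (∀ p ∈ Λ, ‖gabor f p‖ = ‖gabor g p‖) ∧ ¬ AgreeUpToGlobalPhase f g}

/-- The square lattice `aℤ²` in the time-frequency plane. -/
def squareLattice (a : ℝ) : Set (ℝ × ℝ) :=
  {p | ∃ m n : ℤ, p = (a * m, a * n)}

/-- The square lattice `aℤ + iaℤ` in the complex plane. -/
def complexSquareLattice (a : ℝ) : Set ℂ :=
  {z | ∃ m n : ℤ, z = (a : ℂ) * m + Complex.I * ((a : ℂ) * n)}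

/-- The Fock space: entire functions `F` with `∫ |F(z)|² e^{-π|z|²} dz < ∞`. -/
def fockSpace : Set (ℂ → ℂ) :=
  {F | Differentiable ℂ F ∧
    Integrable (fun z : ℂ => ‖F z‖ ^ 2 * Real.exp (-Real.pi * ‖z‖ ^ 2)) volume}

/-- The Bargmann transform
`ℬf(z) = 2^{1/4} ∫ f(t) e^{2πtz - πt² - (π/2)z²} dt`. -/
noncomputable def bargmann (f : L2R) (z : ℂ) : ℂ :=
  (((2 : ℝ) ^ (1 / 4 : ℝ) : ℝ) : ℂ) *
    ∫ t : ℝ, f t * Complex.exp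
      (2 * Real.pi * t * z - Real.pi * (t : ℂ) ^ 2 - Real.pi / 2 * z ^ 2)

/-! Up to a phase and the weight `e^{-π|z|²/2}`, the Gabor transform at `(x, ω)` is the Bargmann
transform at `x - iω`, and the Bargmann transform of the Gaussian is `1`. The theorem therefore
reduces to showing that `F` in Fock space with `|F| = 1` on `aℤ + iaℤ` is constant.

The reproducing kernel gives `|F(z)| ≤ C e^{π|z|²/2}`, so `G(z) = F(az)` has growth of order two and
type `πa²/2 < π/2`. It is bounded by one on the Gaussian integers. A Weierstrass-type function
`sigmaFun`, with simple zeros exactly there and size comparable to `e^{π|z|²/2}` away from them,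
grows faster than `G`. Lagrange interpolation on growing squares and the maximum principle then give
`|G| ≤ K |sigmaFun|` off the lattice (`norm_le_mul_norm_sigmaFun`).

The decisive point is that `K` depends only on `sigmaFun`, not on the growth constants of `G`. The
estimate thus applies with the same `K` to every lattice translate of `G`, which bounds `G` on the
whole plane; Liouville's theorem finishes (`eq_of_bounded_on_gaussPt`).

The bijection onto Fock space comes from Plancherel (isometry) and from the mean value property,
which yields the reproducing formula and hence surjectivity (`exists_bargmann_eq`). -/

/-! ### Plancherel's identity on L¹ ∩ L² -/

open FourierTransform SchwartzMap in
/-- On `L¹ ∩ L²` the Fourier transform of `L²` is the Fourier integral. -/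
theorem coeFn_fourier_toLp_ae_eq {g : ℝ → ℂ} (h1 : Integrable g) (h2 : MemLp g 2) :
    (𝓕 (h2.toLp g) : Lp ℂ 2 (volume : Measure ℝ)) =ᵐ[volume] 𝓕 g := by
  have hc : Continuous (𝓕 g) := by
    exact VectorFourier.fourierIntegral_continuous Real.continuous_fourierChar
      (innerSL ℝ).continuous₂ h1
  -- Test against smooth compactly supported `u`: the distributional Fourier transform moves the
  -- transform onto `u`, and the multiplication formula moves it back onto `g`.
  refine ae_eq_of_integral_contDiff_smul_eq
    ((Lp.memLp _).locallyIntegrable (by norm_num)) hc.locallyIntegrable fun u hu hus => ?_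
  have hs : HasCompactSupport (fun x => (u x : ℂ)) :=
    hus.comp_left (g := fun r : ℝ => (r : ℂ)) Complex.ofReal_zero
  have hd : ContDiff ℝ (⊤ : ℕ∞) (fun x => (u x : ℂ)) :=
    Complex.ofRealCLM.contDiff.comp hu
  set U : 𝓢(ℝ, ℂ) := hs.toSchwartzMap hd with hU
  have hUx : ∀ x, U x = (u x : ℂ) := fun x => rfl
  have e1 : ∫ x, u x • (𝓕 (h2.toLp g) : Lp ℂ 2 (volume : Measure ℝ)) x
      = ∫ x, (𝓕 U) x • (h2.toLp g) x := by
    have := congrArg (fun T => T U) (Lp.fourier_toTemperedDistribution_eq (h2.toLp g))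
    simp only [TemperedDistribution.fourier_apply, Lp.toTemperedDistribution_apply] at this
    rw [this]
    exact integral_congr_ae (Filter.Eventually.of_forall fun x => by simp [hUx])
  have e2 : ∫ x, (𝓕 U) x • (h2.toLp g) x = ∫ x, (𝓕 (U : ℝ → ℂ)) x • g x := by
    refine integral_congr_ae ?_
    filter_upwards [h2.coeFn_toLp] with x hx
    rw [hx, SchwartzMap.fourier_coe]
  have e3 : ∫ x, (𝓕 (U : ℝ → ℂ)) x • g x = ∫ x, U x • 𝓕 g x := by
    have := VectorFourier.integral_fourierIntegral_smul_eq_flip (μ := volume) (ν := volume)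
      (L := innerₗ ℝ) Real.continuous_fourierChar continuous_inner U.integrable h1
    rwa [flip_innerₗ] at this
  rw [e1, e2, e3]
  exact integral_congr_ae (Filter.Eventually.of_forall fun x => by simp [hUx])

open FourierTransform in
/-- Plancherel's identity for the Fourier integral of a function in `L¹ ∩ L²`. -/
theorem lintegral_enorm_fourier_sq {g : ℝ → ℂ} (h1 : Integrable g) (h2 : MemLp g 2) :
    ∫⁻ x, ‖𝓕 g x‖ₑ ^ 2 = ∫⁻ x, ‖g x‖ₑ ^ 2 := by
  have key : eLpNorm (𝓕 g) 2 volume = eLpNorm g 2 volume := by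
    rw [← eLpNorm_congr_ae (coeFn_fourier_toLp_ae_eq h1 h2), ← eLpNorm_congr_ae h2.coeFn_toLp,
      ← Lp.enorm_def, ← Lp.enorm_def, ← ofReal_norm, ← ofReal_norm, Lp.norm_fourier_eq]
  have h := congrArg (fun r => r ^ 2) key
  have hsq (u : ℝ → ℂ) : eLpNorm u 2 volume ^ 2 = ∫⁻ x, ‖u x‖ₑ ^ 2 := by
    simpa using eLpNorm_nnreal_pow_eq_lintegral (f := u) (μ := volume) (p := 2) (by norm_num)
  simpa only [hsq] using h

/-! ### Gaussian integrals and holomorphy of the Bargmann transform -/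

open Complex in
theorem memLp_cexp_quadratic (c d : ℂ) :
    MemLp (fun t : ℝ => cexp (-(Real.pi : ℂ) * (t : ℂ) ^ 2 + c * t + d)) 2 := by
  have hc : Continuous (fun t : ℝ => cexp (-(Real.pi : ℂ) * (t : ℂ) ^ 2 + c * t + d)) := by fun_prop
  rw [memLp_two_iff_integrable_sq_norm hc.aestronglyMeasurable]
  have h := (integrable_cexp_quadratic (b := 2 * (Real.pi : ℂ))
    (by simp [Real.pi_pos]) (2 * c) (2 * d)).norm
  refine h.congr (Filter.Eventually.of_forall fun t => ?_)
  simp only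
  rw [← norm_pow, ← Complex.exp_nat_mul]
  congr 2
  push_cast
  ring

open Complex in
theorem integrable_mul_cexp_quadratic (f : L2R) (c d : ℂ) :
    Integrable (fun t : ℝ => f t * cexp (-(Real.pi : ℂ) * (t : ℂ) ^ 2 + c * t + d)) :=
  (Lp.memLp f).integrable_mul (memLp_cexp_quadratic c d)

open Complex in
theorem differentiable_integral_mul_cexp (f : L2R) :
    Differentiable ℂ (fun z : ℂ =>
      ∫ t : ℝ, f t * cexp (-(Real.pi : ℂ) * (t : ℂ) ^ 2 + 2 * Real.pi * z * t + 0)) := by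
  intro z₀
  -- On the unit ball about `z₀` one has `|Re z| ≤ ‖z₀‖ + 1`; the further unit absorbs the factor
  -- `2π|t| ≤ e^{2π|t|}` of the derivative. Finally `e^{c|t|} ≤ e^{ct} + e^{-ct}`.
  set c : ℝ := 2 * Real.pi * (‖z₀‖ + 2) with hc
  have hm : AEStronglyMeasurable (fun t : ℝ => f t) := (Lp.memLp f).1
  refine (hasDerivAt_integral_of_dominated_loc_of_deriv_le
    (F' := fun z t => f t * (cexp (-(Real.pi : ℂ) * (t : ℂ) ^ 2 + 2 * Real.pi * z * t + 0) *
      (2 * Real.pi * t)))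
    (bound := fun t => ‖f t * cexp (-(Real.pi : ℂ) * (t : ℂ) ^ 2 + (c : ℂ) * t + 0)‖ +
      ‖f t * cexp (-(Real.pi : ℂ) * (t : ℂ) ^ 2 + ((-c : ℝ) : ℂ) * t + 0)‖)
    (Metric.ball_mem_nhds z₀ one_pos)
    (Filter.Eventually.of_forall fun z => (integrable_mul_cexp_quadratic f _ _).1)
    (integrable_mul_cexp_quadratic f _ _) (hm.mul (by fun_prop)) ?_
    ((integrable_mul_cexp_quadratic f _ _).norm.add (integrable_mul_cexp_quadratic f _ _).norm)
    ?_).2.differentiableAt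
  · refine Filter.Eventually.of_forall fun t z hz => ?_
    have hz' : ‖z‖ ≤ ‖z₀‖ + 1 := by
      have := norm_le_norm_add_norm_sub' z z₀
      have h2 : ‖z - z₀‖ < 1 := by simpa [dist_eq_norm] using hz
      linarith
    simp only [norm_mul, ← mul_add]
    refine mul_le_mul_of_nonneg_left ?_ (norm_nonneg _)
    have h1 : ‖(2 : ℂ)‖ * ‖(Real.pi : ℂ)‖ * ‖(t : ℂ)‖ ≤ Real.exp (2 * Real.pi * |t|) := by
      have := Real.add_one_le_exp (2 * Real.pi * |t|)
      simp only [Complex.norm_real, Real.norm_eq_abs, abs_of_pos Real.pi_pos]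
      norm_num
      linarith
    simp only [Complex.norm_exp]
    have e1 : (-(Real.pi : ℂ) * (t : ℂ) ^ 2 + 2 * Real.pi * z * t + 0).re =
        -Real.pi * t ^ 2 + 2 * Real.pi * (z.re * t) := by
      rw [show -(Real.pi : ℂ) * (t : ℂ) ^ 2 + 2 * Real.pi * z * t + 0 =
        ((-Real.pi * t ^ 2 : ℝ) : ℂ) + ((2 * Real.pi * t : ℝ) : ℂ) * z by push_cast; ring]
      rw [add_re, re_ofReal_mul, ofReal_re]; ring
    have e2 (s : ℝ) : (-(Real.pi : ℂ) * (t : ℂ) ^ 2 + (s : ℂ) * t + 0).re =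
        -Real.pi * t ^ 2 + s * t := by
      rw [show -(Real.pi : ℂ) * (t : ℂ) ^ 2 + (s : ℂ) * t + 0 =
        ((-Real.pi * t ^ 2 + s * t : ℝ) : ℂ) by push_cast; ring, ofReal_re]
    rw [e1, e2, e2]
    have h3 : z.re * t ≤ (‖z₀‖ + 1) * |t| := by
      calc z.re * t ≤ |z.re * t| := le_abs_self _
        _ = |z.re| * |t| := abs_mul _ _
        _ ≤ _ := mul_le_mul_of_nonneg_right ((abs_re_le_norm z).trans hz') (abs_nonneg _)
    have h4 : -Real.pi * t ^ 2 + 2 * Real.pi * (z.re * t) + 2 * Real.pi * |t| ≤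
        -Real.pi * t ^ 2 + c * |t| := by
      have := mul_le_mul_of_nonneg_left h3 (by positivity : 0 ≤ 2 * Real.pi)
      rw [hc]; linarith
    calc _ ≤ Real.exp (-Real.pi * t ^ 2 + 2 * Real.pi * (z.re * t)) * Real.exp (2 * Real.pi * |t|) :=
          mul_le_mul_of_nonneg_left h1 (Real.exp_nonneg _)
      _ ≤ Real.exp (-Real.pi * t ^ 2 + c * |t|) := by
          rw [← Real.exp_add]; exact Real.exp_le_exp.2 h4
      _ ≤ _ := by
          rcases abs_choice t with h | h <;> rw [h]
          · linarith [Real.exp_nonneg (-Real.pi * t ^ 2 + -c * t)]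
          · rw [mul_neg, ← neg_mul]; linarith [Real.exp_nonneg (-Real.pi * t ^ 2 + c * t)]
  · refine Filter.Eventually.of_forall fun t z _ => ?_
    refine HasDerivAt.const_mul _ (HasDerivAt.cexp ?_)
    have h := ((hasDerivAt_id z).const_mul ((2 * Real.pi * t : ℂ))).const_add
      (-(Real.pi : ℂ) * (t : ℂ) ^ 2)
    rw [mul_one] at h
    refine h.congr_of_eventuallyEq (Filter.Eventually.of_forall fun w => ?_)
    simp only [id]; ring

open Complex in
theorem bargmann_eq_integral_quadratic (f : L2R) (z : ℂ) :
    bargmann f z = (((2 : ℝ) ^ (1 / 4 : ℝ) : ℝ) : ℂ) * (cexp (-(Real.pi / 2 * z ^ 2)) *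
      ∫ t : ℝ, f t * cexp (-(Real.pi : ℂ) * (t : ℂ) ^ 2 + 2 * Real.pi * z * t + 0)) := by
  rw [bargmann]
  congr 1
  rw [← integral_const_mul]
  refine integral_congr_ae (Filter.Eventually.of_forall fun t => ?_)
  simp only
  rw [mul_left_comm, ← Complex.exp_add]
  congr 2
  ring

theorem differentiable_bargmann (f : L2R) : Differentiable ℂ (bargmann f) := by
  rw [funext (bargmann_eq_integral_quadratic f)]
  have := differentiable_integral_mul_cexp f
  fun_prop

/-! ### Gabor versus Bargmann transform -/

open Complex in
/-- The Gabor transform is the Bargmann transform up to a weight and a phase. -/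
theorem gabor_eq_bargmann (f : L2R) (x ω : ℝ) :
    gabor f (x, ω) = cexp (-(Real.pi / 2 * (x ^ 2 + ω ^ 2)) - Real.pi * I * x * ω) *
      bargmann f (x - ω * I) := by
  rw [gabor, bargmann, mul_left_comm]
  congr 1
  rw [← integral_const_mul]
  refine integral_congr_ae (Filter.Eventually.of_forall fun t => ?_)
  simp only
  rw [mul_assoc, ← Complex.exp_add, mul_left_comm, ← Complex.exp_add]
  congr 2
  linear_combination ((Real.pi : ℂ) / 2 * ω ^ 2) * I_sq

open Complex in
theorem norm_gabor (f : L2R) (x ω : ℝ) :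
    ‖gabor f (x, ω)‖ = Real.exp (-(Real.pi / 2 * ‖(x - ω * I : ℂ)‖ ^ 2)) *
      ‖bargmann f (x - ω * I)‖ := by
  rw [gabor_eq_bargmann, norm_mul, Complex.norm_exp, Complex.sq_norm, normSq_apply]
  congr 2
  rw [show (-(Real.pi / 2 * (x ^ 2 + ω ^ 2)) - Real.pi * I * x * ω : ℂ) =
    ((-(Real.pi / 2 * (x ^ 2 + ω ^ 2)) : ℝ) : ℂ) + ((-(Real.pi * x * ω) : ℝ) : ℂ) * I by
      push_cast; ring]
  rw [add_re, ofReal_re, re_ofReal_mul]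
  simp
  ring

/-! ### The Gabor transform as an isometry -/

open FourierTransform Complex in
theorem gabor_eq_fourier (f : L2R) (x ω : ℝ) :
    gabor f (x, ω) = (((2 : ℝ) ^ (1 / 4 : ℝ) : ℝ) : ℂ) *
      𝓕 (fun t : ℝ => f t * cexp (-(Real.pi : ℂ) * ((t : ℂ) - x) ^ 2)) ω := by
  rw [gabor, Real.fourier_real_eq_integral_exp_smul]
  congr 1
  refine integral_congr_ae (Filter.Eventually.of_forall fun t => ?_)
  simp only [smul_eq_mul]
  rw [mul_comm]
  congr 2
  push_cast
  ring

open Complex in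
theorem enorm_sq_cexp_neg_sq (s : ℝ) :
    ‖cexp (-(Real.pi : ℂ) * (s : ℂ) ^ 2)‖ₑ ^ 2 = ENNReal.ofReal (Real.exp (-(2 * Real.pi) * s ^ 2)) := by
  rw [← ofReal_norm, ← ENNReal.ofReal_pow (norm_nonneg _), Complex.norm_exp, ← Real.exp_nat_mul,
    show -(Real.pi : ℂ) * (s : ℂ) ^ 2 = ((-Real.pi * s ^ 2 : ℝ) : ℂ) by push_cast; ring, ofReal_re]
  congr 2
  push_cast
  ring

/-- For fixed `x` this is Plancherel in `ω`, applied to the signal windowed at `x`; `√2` is the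
square of `2^{1/4}`. -/
theorem lintegral_enorm_gabor_sq_right (f : L2R) (x : ℝ) :
    ∫⁻ ω : ℝ, ‖gabor f (x, ω)‖ₑ ^ 2 = ENNReal.ofReal (Real.sqrt 2) *
      ∫⁻ t : ℝ, ‖f t‖ₑ ^ 2 * ENNReal.ofReal (Real.exp (-(2 * Real.pi) * (t - x) ^ 2)) := by
  have e : (fun t : ℝ => f t * Complex.exp (-(Real.pi : ℂ) * ((t : ℂ) - x) ^ 2)) =
      fun t : ℝ => f t * Complex.exp (-(Real.pi : ℂ) * (t : ℂ) ^ 2 + (2 * Real.pi * x) * t +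
        (-(Real.pi : ℂ) * x ^ 2)) := by
    funext t; congr 2; ring
  have hint : Integrable (fun t : ℝ => f t * Complex.exp (-(Real.pi : ℂ) * ((t : ℂ) - x) ^ 2)) := by
    rw [e]; exact integrable_mul_cexp_quadratic f _ _
  have hL2 : MemLp (fun t : ℝ => f t * Complex.exp (-(Real.pi : ℂ) * ((t : ℂ) - x) ^ 2)) 2 := by
    refine (Lp.memLp f).of_le hint.1 (Filter.Eventually.of_forall fun t => ?_)
    rw [norm_mul]
    refine mul_le_of_le_one_right (norm_nonneg _) ?_
    rw [Complex.norm_exp, show -(Real.pi : ℂ) * ((t : ℂ) - x) ^ 2 =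
      ((-(Real.pi * (t - x) ^ 2) : ℝ) : ℂ) by push_cast; ring, Complex.ofReal_re]
    exact Real.exp_le_one_iff.2 (neg_nonpos.2 (by positivity))
  have hroot : ‖(((2 : ℝ) ^ (1 / 4 : ℝ) : ℝ) : ℂ)‖ₑ ^ 2 = ENNReal.ofReal (Real.sqrt 2) := by
    rw [← ofReal_norm, ← ENNReal.ofReal_pow (norm_nonneg _), Complex.norm_real,
      Real.norm_of_nonneg (by positivity), ← Real.rpow_natCast, ← Real.rpow_mul (by norm_num),
      Real.sqrt_eq_rpow]
    norm_num
  simp_rw [gabor_eq_fourier, enorm_mul, mul_pow, hroot]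
  rw [lintegral_const_mul' _ _ ENNReal.ofReal_ne_top, lintegral_enorm_fourier_sq hint hL2]
  congr 1
  refine lintegral_congr fun t => ?_
  rw [enorm_mul, mul_pow, ← enorm_sq_cexp_neg_sq, Complex.ofReal_sub]

theorem lintegral_exp_neg_two_pi_sq_sub (t : ℝ) :
    ∫⁻ x : ℝ, ENNReal.ofReal (Real.exp (-(2 * Real.pi) * (t - x) ^ 2)) =
      ENNReal.ofReal (Real.sqrt 2)⁻¹ := by
  rw [lintegral_sub_left_eq_self
    (fun s => ENNReal.ofReal (Real.exp (-(2 * Real.pi) * s ^ 2))) t,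
    ← ofReal_integral_eq_lintegral_ofReal (integrable_exp_neg_mul_sq (by positivity))
      (Filter.Eventually.of_forall fun _ => Real.exp_nonneg _), integral_gaussian,
      ← Real.sqrt_inv]
  congr 2
  field_simp

/-- The Gabor transform preserves the `L²` norm. -/
theorem lintegral_lintegral_enorm_gabor_sq (f : L2R) :
    ∫⁻ x : ℝ, ∫⁻ ω : ℝ, ‖gabor f (x, ω)‖ₑ ^ 2 = ∫⁻ t : ℝ, ‖f t‖ₑ ^ 2 := by
  have hf : Measurable (fun t => f t) := (Lp.stronglyMeasurable f).measurable
  simp_rw [lintegral_enorm_gabor_sq_right]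
  rw [lintegral_const_mul' _ _ ENNReal.ofReal_ne_top, lintegral_lintegral_swap]
  · rw [← lintegral_const_mul' _ _ ENNReal.ofReal_ne_top]
    refine lintegral_congr fun t => ?_
    rw [lintegral_const_mul _ (by fun_prop), lintegral_exp_neg_two_pi_sq_sub, mul_left_comm,
      ← ENNReal.ofReal_mul (Real.sqrt_nonneg _), mul_inv_cancel₀ (by positivity),
      ENNReal.ofReal_one, mul_one]
  · refine Measurable.aemeasurable ?_
    simp only [Function.uncurry_def]
    have : Measurable fun p : ℝ × ℝ => ‖f p.2‖ₑ ^ 2 :=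
      (hf.comp measurable_snd).enorm.pow_const 2
    exact this.mul (by fun_prop)

/-! ### Fock space and the Bargmann isometry -/

/-- The function `F` multiplied by the square root of the Fock space weight. -/
noncomputable def weighted (F : ℂ → ℂ) (z : ℂ) : ℂ :=
  F z * ((Real.exp (-(Real.pi / 2 * ‖z‖ ^ 2)) : ℝ) : ℂ)

theorem continuous_weighted {F : ℂ → ℂ} (hF : Continuous F) : Continuous (weighted F) := by
  unfold weighted; fun_prop

theorem norm_weighted (F : ℂ → ℂ) (z : ℂ) :
    ‖weighted F z‖ = ‖F z‖ * Real.exp (-(Real.pi / 2 * ‖z‖ ^ 2)) := by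
  rw [weighted, norm_mul, Complex.norm_real, Real.norm_of_nonneg (Real.exp_nonneg _)]

theorem mem_fockSpace_iff {F : ℂ → ℂ} :
    F ∈ fockSpace ↔ Differentiable ℂ F ∧ MemLp (weighted F) 2 := by
  refine and_congr_right fun hF => ?_
  rw [memLp_two_iff_integrable_sq_norm (continuous_weighted hF.continuous).aestronglyMeasurable]
  refine iff_of_eq (congrArg (fun g => Integrable g volume) (funext fun z => ?_))
  rw [norm_weighted, mul_pow, ← Real.exp_nat_mul]
  congr 2
  push_cast
  ring

theorem eLpNorm_weighted_bargmann (f : L2R) :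
    eLpNorm (weighted (bargmann f)) 2 volume = eLpNorm f 2 volume := by
  have hsq {α : Type} [MeasurableSpace α] (μ : Measure α) (u : α → ℂ) :
      eLpNorm u 2 μ ^ 2 = ∫⁻ x, ‖u x‖ₑ ^ 2 ∂μ := by
    simpa using eLpNorm_nnreal_pow_eq_lintegral (f := u) (μ := μ) (p := 2) (by norm_num)
  have hinj : Function.Injective fun r : ENNReal => r ^ 2 :=
    (ENNReal.pow_right_strictMono two_ne_zero).injective
  apply hinj
  simp only [hsq]
  have hcont := continuous_weighted (differentiable_bargmann f).continuous
  rw [← lintegral_lintegral_enorm_gabor_sq f,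
    ← Complex.volume_preserving_equiv_real_prod.symm.lintegral_comp_emb
      Complex.measurableEquivRealProd.symm.measurableEmbedding]
  rw [Measure.volume_eq_prod, lintegral_prod]
  · refine lintegral_congr fun x => ?_
    -- `norm_gabor` evaluates at `x - iω`; the reflection of `ω` turns this into `x + iy`.
    rw [← lintegral_neg_eq_self (fun ω => ‖gabor f (x, ω)‖ₑ ^ 2)]
    refine lintegral_congr fun y => ?_
    rw [← ofReal_norm, ← ofReal_norm, norm_weighted, norm_gabor, mul_comm]
    have : Complex.measurableEquivRealProd.symm (x, y) = (x - ((-y : ℝ) : ℂ) * Complex.I) := by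
      rw [Complex.measurableEquivRealProd_symm_apply]
      apply Complex.ext <;> simp
    rw [this]
  · refine Measurable.aemeasurable ?_
    exact (hcont.measurable.comp Complex.measurableEquivRealProd.symm.measurable).enorm.pow_const 2

theorem memLp_weighted_bargmann (f : L2R) : MemLp (weighted (bargmann f)) 2 :=
  ⟨(continuous_weighted (differentiable_bargmann f).continuous).aestronglyMeasurable, by
    rw [eLpNorm_weighted_bargmann]; exact (Lp.memLp f).2⟩

theorem bargmann_mem_fockSpace (f : L2R) : bargmann f ∈ fockSpace :=
  mem_fockSpace_iff.2 ⟨differentiable_bargmann f, memLp_weighted_bargmann f⟩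

theorem bargmann_add (f g : L2R) (z : ℂ) :
    bargmann (f + g) z = bargmann f z + bargmann g z := by
  simp only [bargmann_eq_integral_quadratic, ← mul_add]
  rw [← integral_add (integrable_mul_cexp_quadratic f _ _) (integrable_mul_cexp_quadratic g _ _)]
  congr 2
  refine integral_congr_ae ?_
  filter_upwards [Lp.coeFn_add f g] with t ht
  rw [ht, Pi.add_apply, add_mul]

theorem bargmann_smul (c : ℂ) (f : L2R) (z : ℂ) : bargmann (c • f) z = c * bargmann f z := by
  rw [bargmann, bargmann, mul_left_comm]
  congr 1
  rw [← integral_const_mul]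
  refine integral_congr_ae ?_
  filter_upwards [Lp.coeFn_smul c f] with t ht
  rw [ht, Pi.smul_apply, smul_eq_mul, mul_assoc]

/-- The Bargmann transform as a linear isometry of `L²(ℝ)` into `L²(ℂ)`. -/
noncomputable def bargmannIsometry : L2R →ₗᵢ[ℂ] Lp ℂ 2 (volume : Measure ℂ) where
  toFun f := (memLp_weighted_bargmann f).toLp _
  map_add' f g := by
    rw [← MemLp.toLp_add]
    congr 1
    funext z
    simp only [weighted, bargmann_add, add_mul, Pi.add_apply]
  map_smul' c f := by
    rw [RingHom.id_apply, ← MemLp.toLp_const_smul]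
    congr 1
    funext z
    simp only [weighted, bargmann_smul, Pi.smul_apply, smul_eq_mul, mul_assoc]
  norm_map' f := by
    change ‖(memLp_weighted_bargmann f).toLp _‖ = ‖f‖
    rw [Lp.norm_toLp, eLpNorm_weighted_bargmann, Lp.norm_def]

/-! ### Coherent states, the reproducing kernel and surjectivity -/

/-- The function representing evaluation of the Bargmann transform at `w`. -/
noncomputable def coherentFun (w : ℂ) (t : ℝ) : ℂ :=
  (((2 : ℝ) ^ (1 / 4 : ℝ) : ℝ) : ℂ) * Complex.exp (-(Real.pi : ℂ) * (t : ℂ) ^ 2 +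
    (2 * Real.pi * star w) * t + -(Real.pi / 2 * star w ^ 2))

theorem memLp_coherentFun (w : ℂ) : MemLp (coherentFun w) 2 :=
  (memLp_cexp_quadratic _ _).const_mul _

/-- The element of `L²(ℝ)` representing evaluation of the Bargmann transform at `w`. -/
noncomputable def coherent (w : ℂ) : L2R := (memLp_coherentFun w).toLp _

theorem star_coherentFun (w : ℂ) (t : ℝ) :
    star (coherentFun w t) = (((2 : ℝ) ^ (1 / 4 : ℝ) : ℝ) : ℂ) * Complex.exp
      (2 * Real.pi * t * w - Real.pi * (t : ℂ) ^ 2 - Real.pi / 2 * w ^ 2) := by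
  simp only [coherentFun, Complex.star_def, map_mul, Complex.conj_ofReal, ← Complex.exp_conj,
    map_add, map_neg, map_pow, map_ofNat, Complex.conj_conj, map_div₀]
  congr 2
  ring

theorem bargmann_eq_inner (f : L2R) (z : ℂ) : bargmann f z = inner ℂ (coherent z) f := by
  rw [L2.inner_def, bargmann, ← integral_const_mul]
  refine integral_congr_ae ?_
  filter_upwards [(memLp_coherentFun z).coeFn_toLp] with t ht
  rw [coherent, ht, RCLike.inner_apply]
  have := star_coherentFun z t
  rw [Complex.star_def] at this
  rw [this]
  ring

open Complex in
theorem bargmann_coherent (w z : ℂ) :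
    bargmann (coherent w) z = cexp (Real.pi * z * star w) := by
  have hroot : (((2 : ℝ) ^ (1 / 4 : ℝ) : ℝ) : ℂ) * (((2 : ℝ) ^ (1 / 4 : ℝ) : ℝ) : ℂ) =
      ((Real.sqrt 2 : ℝ) : ℂ) := by
    rw [← ofReal_mul, ← Real.rpow_add (by norm_num), Real.sqrt_eq_rpow]; norm_num
  have e : bargmann (coherent w) z = ((Real.sqrt 2 : ℝ) : ℂ) * ∫ t : ℝ,
      cexp (-(2 * Real.pi : ℂ) * (t : ℂ) ^ 2 + (2 * Real.pi * (z + star w)) * t +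
        -(Real.pi / 2 * (z ^ 2 + star w ^ 2))) := by
    rw [bargmann, ← hroot, mul_assoc]
    congr 1
    rw [← integral_const_mul]
    refine integral_congr_ae ?_
    filter_upwards [(memLp_coherentFun w).coeFn_toLp] with t ht
    rw [coherent, ht, coherentFun, mul_assoc, ← Complex.exp_add]
    congr 2
    ring
  rw [e, integral_cexp_quadratic (by simp [Real.pi_pos]), ← mul_assoc]
  have h1 : (Real.pi / -(-(2 * Real.pi)) : ℂ) ^ (1 / 2 : ℂ) = (((Real.sqrt 2)⁻¹ : ℝ) : ℂ) := by
    rw [show (Real.pi / -(-(2 * Real.pi)) : ℂ) = ((2⁻¹ : ℝ) : ℂ) by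
      have : (Real.pi : ℂ) ≠ 0 := by exact_mod_cast Real.pi_ne_zero
      push_cast; field_simp,
      show (1 / 2 : ℂ) = ((1 / 2 : ℝ) : ℂ) by push_cast; rfl,
      ← ofReal_cpow (by norm_num), ← Real.sqrt_eq_rpow, Real.sqrt_inv]
  rw [h1, ← ofReal_mul, mul_inv_cancel₀ (by positivity), ofReal_one, one_mul]
  congr 1
  have : (Real.pi : ℂ) ≠ 0 := by exact_mod_cast Real.pi_ne_zero
  field_simp
  ring

theorem gaussian_eq_coherent_zero : gaussian = coherent 0 := by
  unfold gaussian coherent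
  congr 1
  funext t
  rw [gaussianFun, coherentFun]
  push_cast
  simp

theorem bargmann_gaussian (z : ℂ) : bargmann gaussian z = 1 := by
  rw [gaussian_eq_coherent_zero, bargmann_coherent]; simp

theorem norm_coherent_sq (z : ℂ) : ‖coherent z‖ ^ 2 = Real.exp (Real.pi * ‖z‖ ^ 2) := by
  have h := bargmann_coherent z z
  rw [bargmann_eq_inner, inner_self_eq_norm_sq_to_K, mul_assoc, Complex.star_def,
    Complex.mul_conj, Complex.normSq_eq_norm_sq] at h
  refine Complex.ofReal_injective ?_
  push_cast at h ⊢
  exact h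

theorem norm_bargmann_le (f : L2R) (z : ℂ) :
    ‖bargmann f z‖ ≤ ‖f‖ * Real.exp (Real.pi / 2 * ‖z‖ ^ 2) := by
  have h : ‖coherent z‖ = Real.exp (Real.pi / 2 * ‖z‖ ^ 2) := by
    rw [← sq_eq_sq₀ (norm_nonneg _) (Real.exp_nonneg _), norm_coherent_sq, ← Real.exp_nat_mul]
    congr 1; push_cast; ring
  rw [bargmann_eq_inner, ← h, mul_comm]
  exact norm_inner_le_norm _ _

/-- The mean value property of entire functions with respect to the Gaussian measure. -/
theorem integral_mul_exp_neg_sq {F : ℂ → ℂ} (hF : Differentiable ℂ F)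
    (hi : Integrable fun z : ℂ => F z * ((Real.exp (-Real.pi * ‖z‖ ^ 2) : ℝ) : ℂ)) :
    ∫ z : ℂ, F z * ((Real.exp (-Real.pi * ‖z‖ ^ 2) : ℝ) : ℂ) = F 0 := by
  set g : ℂ → ℂ := fun z => F z * ((Real.exp (-Real.pi * ‖z‖ ^ 2) : ℝ) : ℂ) with hg
  have hgc : Continuous g := by have := hF.continuous; fun_prop
  have hpol (p : ℝ × ℝ) : Complex.polarCoord.symm p = circleMap 0 p.1 p.2 := by
    rw [Complex.polarCoord_symm_apply, circleMap, zero_add, Complex.exp_mul_I,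
      Complex.ofReal_cos, Complex.ofReal_sin]
  have hcm : Continuous fun p : ℝ × ℝ => circleMap 0 p.1 p.2 := by
    unfold circleMap; fun_prop
  have hint : IntegrableOn (fun p : ℝ × ℝ => p.1 • g (Complex.polarCoord.symm p))
      (Set.Ioi (0 : ℝ) ×ˢ Set.Ioo (-Real.pi) Real.pi) (volume.prod volume) := by
    simp_rw [hpol]
    refine ⟨Continuous.aestronglyMeasurable (by fun_prop), ?_⟩
    have h := hi.2
    rw [hasFiniteIntegral_iff_enorm, ← Complex.lintegral_comp_polarCoord_symm] at h
    rw [hasFiniteIntegral_iff_enorm]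
    refine lt_of_eq_of_lt ?_ h
    rw [polarCoord_target]
    refine setLIntegral_congr_fun (measurableSet_Ioi.prod measurableSet_Ioo) fun p hp => ?_
    simp only [enorm_smul, hpol, smul_eq_mul]
    rw [Real.enorm_of_nonneg (le_of_lt hp.1)]
  rw [← Complex.integral_comp_polarCoord_symm, polarCoord_target, Measure.volume_eq_prod,
    setIntegral_prod _ hint]
  -- The average of `F` over each circle is `F 0`; the remaining radial integral of `r e^{-πr²}` is
  -- `1/(2π)`.
  have hmean (r : ℝ) (hr : 0 < r) : ∫ θ in Set.Ioo (-Real.pi) Real.pi,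
      r • g (Complex.polarCoord.symm (r, θ)) =
        ((r : ℂ) * Complex.exp (-(Real.pi : ℂ) * r ^ 2)) * (2 * Real.pi * F 0) := by
    have havg : Real.circleAverage F 0 r = F 0 :=
      DiffContOnCl.circleAverage hF.diffContOnCl
    have hper : Function.Periodic (fun θ => F (circleMap 0 r θ)) (2 * Real.pi) := fun θ => by
      simp only [periodic_circleMap 0 r θ]
    have hI : ∫ θ in (-Real.pi)..Real.pi, F (circleMap 0 r θ) = 2 * Real.pi * F 0 := by
      have h2 := hper.intervalIntegral_add_eq (-Real.pi) 0
      rw [show -Real.pi + 2 * Real.pi = Real.pi by ring, zero_add] at h2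
      rw [h2, ← havg, Real.circleAverage_def, Complex.real_smul]
      have : (Real.pi : ℂ) ≠ 0 := by exact_mod_cast Real.pi_ne_zero
      push_cast
      field_simp
    rw [← integral_Ioc_eq_integral_Ioo,
      ← intervalIntegral.integral_of_le (by linarith [Real.pi_pos]), ← hI,
      ← intervalIntegral.integral_const_mul]
    refine intervalIntegral.integral_congr fun θ _ => ?_
    simp only [hpol, hg, norm_circleMap_zero, Complex.real_smul, sq_abs]
    push_cast
    ring
  rw [setIntegral_congr_fun measurableSet_Ioi hmean, integral_mul_const,
    integral_mul_cexp_neg_mul_sq (by simp [Real.pi_pos])]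
  have : (Real.pi : ℂ) ≠ 0 := by exact_mod_cast Real.pi_ne_zero
  field_simp

/-- The reproducing property of the exponential kernel of Fock space. -/
theorem inner_bargmannIsometry_coherent {F : ℂ → ℂ} (hF : Differentiable ℂ F)
    (h2 : MemLp (weighted F) 2) (w : ℂ) :
    inner ℂ (bargmannIsometry (coherent w)) (h2.toLp (weighted F)) = F w := by
  have hB : bargmannIsometry (coherent w) = (memLp_weighted_bargmann (coherent w)).toLp _ := rfl
  set k : ℂ → ℂ := fun z => weighted F z * star (weighted (bargmann (coherent w)) z) with hk
  have hki : Integrable k := h2.integrable_mul (memLp_weighted_bargmann (coherent w)).star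
  have e1 : inner ℂ (bargmannIsometry (coherent w)) (h2.toLp (weighted F)) = ∫ z, k z := by
    rw [L2.inner_def]
    refine integral_congr_ae ?_
    filter_upwards [h2.coeFn_toLp, (memLp_weighted_bargmann (coherent w)).coeFn_toLp] with z h3 h4
    rw [h3, hB, h4, RCLike.inner_apply]
    rfl
  -- Translation by `w` cancels the antiholomorphic part of the kernel, leaving an entire function
  -- against the weight centred at `0`. Its Gaussian mean is its value at `0`, namely `F w`.
  have e2 (z : ℂ) : k (z + w) = (F (z + w) * Complex.exp (-(Real.pi * z * star w))) *
      ((Real.exp (-Real.pi * ‖z‖ ^ 2) : ℝ) : ℂ) := by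
    have hn (u : ℂ) : ((‖u‖ : ℂ)) ^ 2 = u * star u := by
      rw [Complex.star_def, Complex.mul_conj, Complex.normSq_eq_norm_sq]; push_cast; rfl
    simp only [hk, weighted, bargmann_coherent, star_mul', Complex.star_def, Complex.conj_ofReal,
      ← Complex.exp_conj, map_mul, map_add, Complex.conj_conj]
    push_cast
    simp only [mul_assoc, ← Complex.exp_add, hn, Complex.star_def, map_add]
    congr 2
    ring
  have hd : Differentiable ℂ fun z => F (z + w) * Complex.exp (-(Real.pi * z * star w)) := by
    fun_prop
  have h5 := integral_mul_exp_neg_sq hd (by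
    have := hki.comp_add_right w
    simpa only [e2] using this)
  rw [e1, ← integral_add_right_eq_self k w]
  simp_rw [e2]
  rw [h5]
  simp

/-- The range of an isometry is closed, so `F` splits into a Bargmann transform and a remainder
orthogonal to the range. The remainder is represented by a weighted entire function, whose value at
each `w` is an inner product with the image of `coherent w`, hence zero. -/
theorem exists_bargmann_eq {F : ℂ → ℂ} (hF : F ∈ fockSpace) : ∃ f : L2R, bargmann f = F := by
  obtain ⟨hd, hm⟩ := mem_fockSpace_iff.1 hF
  have hcomp : CompleteSpace (LinearMap.range bargmannIsometry.toLinearMap) :=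
    (bargmannIsometry.isometry.isClosedEmbedding.isClosed_range).completeSpace_coe
  obtain ⟨v, ⟨f, hf⟩, v', hv', huv⟩ :=
    (LinearMap.range bargmannIsometry.toLinearMap).exists_add_mem_mem_orthogonal
      (hm.toLp (weighted F))
  have hB : bargmannIsometry f = (memLp_weighted_bargmann f).toLp _ := rfl
  have hw : weighted (F - bargmann f) = weighted F - weighted (bargmann f) := by
    funext z; simp only [weighted, Pi.sub_apply, sub_mul]
  have hm' : MemLp (weighted (F - bargmann f)) 2 := hw ▸ hm.sub (memLp_weighted_bargmann f)
  have hv : hm'.toLp _ = v' := by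
    have h1 : hm'.toLp _ = hm.toLp _ - (memLp_weighted_bargmann f).toLp _ := by
      rw [← MemLp.toLp_sub]
      congr 1
    rw [h1, huv, ← hB, ← hf]
    exact add_sub_cancel_left _ _
  refine ⟨f, funext fun w => ?_⟩
  have h := inner_bargmannIsometry_coherent (hd.sub (differentiable_bargmann f)) hm' w
  have h0 : inner ℂ (bargmannIsometry (coherent w)) v' = 0 := hv' _ ⟨coherent w, rfl⟩
  rw [hv, h0] at h
  exact (sub_eq_zero.1 h.symm).symm

theorem bargmann_injective : Function.Injective bargmann := fun f g h => by
  apply bargmannIsometry.injective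
  change (memLp_weighted_bargmann f).toLp _ = (memLp_weighted_bargmann g).toLp _
  congr 1
  rw [h]

theorem bijOn_bargmann : Set.BijOn bargmann Set.univ fockSpace :=
  ⟨fun f _ => bargmann_mem_fockSpace f, bargmann_injective.injOn, fun _ hF =>
    (exists_bargmann_eq hF).imp fun _ h => ⟨trivial, h⟩⟩

/-! ### A sigma-type function of the square lattice -/

/-- The nome `e^{-2π}` of the square lattice. -/
noncomputable def nome : ℂ := ((Real.exp (-(2 * Real.pi)) : ℝ) : ℂ)

theorem norm_nome_lt_one : ‖nome‖ < 1 := by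
  rw [nome, Complex.norm_real, Real.norm_of_nonneg (Real.exp_nonneg _), Real.exp_lt_one_iff]
  linarith [Real.pi_pos]

theorem nome_eq_cexp : nome = Complex.exp (-(2 * Real.pi)) := by
  rw [nome]; push_cast; rfl

theorem nome_pow_eq_cexp (n : ℕ) : nome ^ n = Complex.exp (-(2 * Real.pi * n)) := by
  rw [nome_eq_cexp, ← Complex.exp_nat_mul]; congr 1; ring

/-- The infinite product `∏ (1 - qⁿ w)` at the nome `q = e^{-2π}`. -/
noncomputable def nomeProd (w : ℂ) : ℂ := ∏' n : ℕ, (1 + -(nome ^ n * w))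

theorem summable_norm_nome_pow_mul (w : ℂ) : Summable fun n : ℕ => ‖-(nome ^ n * w)‖ := by
  simp_rw [norm_neg, norm_mul, norm_pow]
  exact (summable_geometric_of_lt_one (norm_nonneg _) norm_nome_lt_one).mul_right _

/-- Splitting off the factor `n = 0`. This functional equation exhibits the zero of `sigmaFun` at
the origin and drives its quasi-periodicity under `i`. -/
theorem nomeProd_eq (w : ℂ) : nomeProd w = (1 - w) * nomeProd (nome * w) := by
  have e (n : ℕ) : nome ^ (n + 1) * w = nome ^ n * (nome * w) := by ring
  rw [nomeProd, tprod_eq_zero_mul', nomeProd]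
  · simp_rw [e]
    rw [pow_zero, one_mul, sub_eq_add_neg]
  · simp_rw [e]
    exact multipliable_one_add_of_summable (summable_norm_nome_pow_mul _)

theorem nomeProd_ne_zero {w : ℂ} (h : ∀ n : ℕ, nome ^ n * w ≠ 1) : nomeProd w ≠ 0 :=
  tprod_one_add_ne_zero_of_summable
    (fun n hn => h n (by linear_combination -hn)) (summable_norm_nome_pow_mul w)

theorem differentiable_nomeProd : Differentiable ℂ nomeProd := by
  intro w₀
  have h : HasProdLocallyUniformlyOn (fun (n : ℕ) (w : ℂ) => 1 + -(nome ^ n * w)) nomeProd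
      (Metric.ball 0 (‖w₀‖ + 1)) := by
    refine Summable.hasProdLocallyUniformlyOn_nat_one_add (u := fun n => ‖nome‖ ^ n * (‖w₀‖ + 1))
      Metric.isOpen_ball
      ((summable_geometric_of_lt_one (norm_nonneg _) norm_nome_lt_one).mul_right _)
      (Filter.Eventually.of_forall fun n w hw => ?_) fun n => by fun_prop
    rw [norm_neg, norm_mul, norm_pow]
    exact mul_le_mul_of_nonneg_left (mem_ball_zero_iff.1 hw).le (by positivity)
  have hd := h.differentiableOn (Filter.Eventually.of_forall fun s => by
    simpa [Finset.prod_fn] using DifferentiableOn.finsetProd (fun _ _ ↦ by fun_prop))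
    Metric.isOpen_ball
  exact hd.differentiableAt (Metric.isOpen_ball.mem_nhds (by simp))

/-- An entire function with simple zeros exactly at the Gaussian integers whose modulus is
`e^{π|z|²/2}` up to a doubly periodic factor. -/
noncomputable def sigmaFun (z : ℂ) : ℂ :=
  nomeProd (Complex.exp (2 * Real.pi * Complex.I * z)) *
    nomeProd (nome * Complex.exp (-(2 * Real.pi * Complex.I * z))) *
    Complex.exp (Real.pi / 2 * z ^ 2 - Real.pi * Complex.I * z)

theorem differentiable_sigmaFun : Differentiable ℂ sigmaFun := by
  have := differentiable_nomeProd
  unfold sigmaFun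
  fun_prop

theorem sigmaFun_eq (z : ℂ) :
    sigmaFun z = (1 - Complex.exp (2 * Real.pi * Complex.I * z)) *
      (nomeProd (nome * Complex.exp (2 * Real.pi * Complex.I * z)) *
        nomeProd (nome * Complex.exp (-(2 * Real.pi * Complex.I * z))) *
        Complex.exp (Real.pi / 2 * z ^ 2 - Real.pi * Complex.I * z)) := by
  rw [sigmaFun, nomeProd_eq (Complex.exp (2 * Real.pi * Complex.I * z))]
  ring

/-- The first product can vanish only at lattice points with imaginary part `-n ≤ 0`, the second
only at those with imaginary part `n + 1 > 0`; its extra `nome` avoids counting the real integers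
twice. -/
theorem exists_int_of_sigmaFun_eq_zero {z : ℂ} (hz : sigmaFun z = 0) :
    ∃ m n : ℤ, z = m + n * Complex.I := by
  have h2 : (2 * Real.pi * Complex.I : ℂ) ≠ 0 := Complex.two_pi_I_ne_zero
  rw [sigmaFun, mul_eq_zero, or_iff_left (Complex.exp_ne_zero _), mul_eq_zero] at hz
  by_contra hne
  rcases hz with h | h
  · refine nomeProd_ne_zero (fun n hn => hne ?_) h
    rw [nome_pow_eq_cexp, ← Complex.exp_add, Complex.exp_eq_one_iff] at hn
    obtain ⟨k, hk⟩ := hn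
    refine ⟨k, -n, mul_left_cancel₀ h2 ?_⟩
    push_cast
    linear_combination hk + 2 * Real.pi * n * Complex.I_sq
  · refine nomeProd_ne_zero (fun n hn => hne ?_) h
    rw [← mul_assoc, ← pow_succ, nome_pow_eq_cexp, ← Complex.exp_add, Complex.exp_eq_one_iff] at hn
    obtain ⟨k, hk⟩ := hn
    refine ⟨-k, n + 1, mul_left_cancel₀ h2 ?_⟩
    push_cast at hk ⊢
    linear_combination -hk - 2 * Real.pi * (n + 1) * Complex.I_sq

theorem sigmaFun_zero : sigmaFun 0 = 0 := by
  rw [sigmaFun_eq]; simp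

theorem deriv_sigmaFun_zero_ne_zero : deriv sigmaFun 0 ≠ 0 := by
  set g : ℂ → ℂ := fun z => nomeProd (nome * Complex.exp (2 * Real.pi * Complex.I * z)) *
        nomeProd (nome * Complex.exp (-(2 * Real.pi * Complex.I * z))) *
        Complex.exp (Real.pi / 2 * z ^ 2 - Real.pi * Complex.I * z) with hg
  have hgd : Differentiable ℂ g := by
    have := differentiable_nomeProd
    fun_prop
  have h1 : HasDerivAt (fun z : ℂ => 1 - Complex.exp (2 * Real.pi * Complex.I * z))
      (-(2 * Real.pi * Complex.I)) 0 := by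
    have := (((hasDerivAt_id (0 : ℂ)).const_mul (2 * Real.pi * Complex.I : ℂ)).cexp).const_sub 1
    simpa using this
  have h2 := h1.mul (hgd 0).hasDerivAt
  have h3 : sigmaFun = (fun z : ℂ => 1 - Complex.exp (2 * Real.pi * Complex.I * z)) * g := by
    funext z; exact sigmaFun_eq z
  have hP : nomeProd nome ≠ 0 := nomeProd_ne_zero fun n hn => by
    rw [← pow_succ] at hn
    have h4 := congrArg norm hn
    rw [norm_pow, norm_one] at h4
    exact absurd h4 (pow_lt_one₀ (norm_nonneg _) norm_nome_lt_one n.succ_ne_zero).ne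
  rw [h3, h2.deriv]
  simp [hg, hP, Real.pi_ne_zero]

/-- The modulus of `sigmaFun` in the Fock space weight. -/
noncomputable def sigmaMod (z : ℂ) : ℝ := ‖sigmaFun z‖ * Real.exp (-(Real.pi / 2 * ‖z‖ ^ 2))

theorem continuous_sigmaMod : Continuous sigmaMod := by
  have := differentiable_sigmaFun.continuous
  unfold sigmaMod
  fun_prop

theorem norm_sigmaFun (z : ℂ) :
    ‖sigmaFun z‖ = sigmaMod z * Real.exp (Real.pi / 2 * ‖z‖ ^ 2) := by
  rw [sigmaMod, mul_assoc, ← Real.exp_add, neg_add_cancel, Real.exp_zero, mul_one]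

/-- The factor `e^{πz²/2}` is chosen so that the dependence on `Re z` cancels against the weight,
leaving the exponent `π y - π y²` with `y = Im z`. -/
theorem sigmaMod_eq (z : ℂ) :
    sigmaMod z = ‖nomeProd (Complex.exp (2 * Real.pi * Complex.I * z)) *
      nomeProd (nome * Complex.exp (-(2 * Real.pi * Complex.I * z)))‖ *
        Real.exp (Real.pi * z.im - Real.pi * z.im ^ 2) := by
  rw [sigmaMod, sigmaFun, norm_mul, mul_assoc, Complex.norm_exp, ← Real.exp_add,
    Complex.sq_norm, Complex.normSq_apply]
  congr 2
  rw [show (Real.pi / 2 * z ^ 2 - Real.pi * Complex.I * z : ℂ) =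
    ((Real.pi / 2 : ℝ) : ℂ) * z ^ 2 - ((Real.pi : ℝ) : ℂ) * (Complex.I * z) by push_cast; ring,
    Complex.sub_re, Complex.re_ofReal_mul, Complex.re_ofReal_mul, sq z, Complex.mul_re,
    Complex.I_mul_re]
  ring

theorem periodic_sigmaMod_one : Function.Periodic sigmaMod 1 := fun z => by
  have e : Complex.exp (2 * Real.pi * Complex.I * (z + 1)) =
      Complex.exp (2 * Real.pi * Complex.I * z) := by
    rw [mul_add, mul_one, Complex.exp_add, Complex.exp_two_pi_mul_I, mul_one]
  rw [sigmaMod_eq, sigmaMod_eq, Complex.exp_neg, e, ← Complex.exp_neg]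
  simp

theorem periodic_sigmaMod_I : Function.Periodic sigmaMod Complex.I := fun z => by
  set w := Complex.exp (2 * Real.pi * Complex.I * z) with hw
  have hw0 : w ≠ 0 := Complex.exp_ne_zero _
  have e1 : Complex.exp (2 * Real.pi * Complex.I * (z + Complex.I)) = nome * w := by
    rw [nome_eq_cexp, hw, ← Complex.exp_add]
    congr 1
    linear_combination 2 * Real.pi * Complex.I_sq
  have e2 : Complex.exp (-(2 * Real.pi * Complex.I * z)) = w⁻¹ := Complex.exp_neg _
  have hn0 : nome ≠ 0 := by rw [nome_eq_cexp]; exact Complex.exp_ne_zero _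
  -- The shift by `i` multiplies the product by `-w⁻¹`, of modulus `e^{2πy}` with `y = Im z`;
  -- replacing `y` by `y + 1` in `π y - π y²` subtracts exactly `2πy`.
  have e3 : nomeProd (nome * w) * nomeProd (nome * (nome * w)⁻¹) =
      -w⁻¹ * (nomeProd w * nomeProd (nome * w⁻¹)) := by
    rw [show nome * (nome * w)⁻¹ = w⁻¹ by field_simp, nomeProd_eq w, nomeProd_eq w⁻¹]
    field_simp
    ring
  have e4 : ‖-w⁻¹‖ = Real.exp (2 * Real.pi * z.im) := by
    rw [norm_neg, ← e2, Complex.norm_exp]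
    congr 1
    rw [show -(2 * Real.pi * Complex.I * z) = ((-(2 * Real.pi) : ℝ) : ℂ) * (Complex.I * z) by
      push_cast; ring, Complex.re_ofReal_mul, Complex.I_mul_re]
    ring
  rw [sigmaMod_eq, sigmaMod_eq, Complex.exp_neg, e1, e3, e2, norm_mul, e4,
    mul_comm (Real.exp _), mul_assoc, ← Real.exp_add]
  congr 2
  simp
  ring

theorem sigmaMod_add_lattice (z : ℂ) (m n : ℤ) :
    sigmaMod (z + (m + n * Complex.I)) = sigmaMod z := by
  rw [← add_assoc, periodic_sigmaMod_I.int_mul n (z + m)]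
  simpa using periodic_sigmaMod_one.int_mul m z

theorem sigmaFun_lattice (m n : ℤ) : sigmaFun (m + n * Complex.I) = 0 := by
  rw [← norm_eq_zero, norm_sigmaFun, ← zero_add ((m : ℂ) + n * Complex.I), sigmaMod_add_lattice,
    sigmaMod, sigmaFun_zero, norm_zero, zero_mul, zero_mul]

/-- Periodicity is available for the modulus only, so the derivative is reached through difference
quotients: `|sigmaFun (l + t)|` equals `|sigmaFun t|` times `e^{π(|l + t|² - |t|²)/2}`. The
resulting growth makes the interpolation coefficients summable. -/
theorem norm_deriv_sigmaFun_lattice (m n : ℤ) :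
    ‖deriv sigmaFun (m + n * Complex.I)‖ =
      ‖deriv sigmaFun 0‖ * Real.exp (Real.pi / 2 * ((m : ℝ) ^ 2 + (n : ℝ) ^ 2)) := by
  set l : ℂ := m + n * Complex.I with hl
  have hd (x : ℂ) := (hasDerivAt_iff_tendsto_slope_zero.1
    (differentiable_sigmaFun x).hasDerivAt).norm
  have hnl : ‖l‖ ^ 2 = (m : ℝ) ^ 2 + (n : ℝ) ^ 2 := by
    rw [Complex.sq_norm, Complex.normSq_apply, hl]; simp; ring
  have h0 : Filter.Tendsto (fun t : ℂ => Real.exp (Real.pi / 2 * (‖l + t‖ ^ 2 - ‖t‖ ^ 2)))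
      (nhdsWithin 0 {0}ᶜ) (nhds (Real.exp (Real.pi / 2 * ((m : ℝ) ^ 2 + (n : ℝ) ^ 2)))) := by
    have hc : Continuous (fun t : ℂ => Real.exp (Real.pi / 2 * (‖l + t‖ ^ 2 - ‖t‖ ^ 2))) := by
      fun_prop
    have := hc.tendsto 0
    simp only [add_zero, norm_zero, hnl] at this
    norm_num at this
    exact this.mono_left nhdsWithin_le_nhds
  refine tendsto_nhds_unique (hd l) (((hd 0).mul h0).congr fun t => ?_)
  have h1 : sigmaMod (l + t) = sigmaMod t := by
    rw [add_comm, hl]; exact sigmaMod_add_lattice t m n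
  rw [zero_add, sigmaFun_zero, sigmaFun_lattice, sub_zero, sub_zero, norm_smul, norm_smul,
    norm_sigmaFun, norm_sigmaFun, h1, mul_assoc, mul_assoc, ← Real.exp_add]
  congr 3
  ring

/-! ### Estimates at and away from the Gaussian integers -/

/-- The Gaussian integer `m + n i` as a complex number. -/
noncomputable def gaussPt (p : ℤ × ℤ) : ℂ := p.1 + p.2 * Complex.I

theorem gaussPt_re (p : ℤ × ℤ) : (gaussPt p).re = p.1 := by simp [gaussPt]

theorem gaussPt_im (p : ℤ × ℤ) : (gaussPt p).im = p.2 := by simp [gaussPt]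

theorem gaussPt_injective : Function.Injective gaussPt := fun p q h => by
  have h1 := congrArg Complex.re h
  have h2 := congrArg Complex.im h
  rw [gaussPt_re, gaussPt_re] at h1
  rw [gaussPt_im, gaussPt_im] at h2
  exact Prod.ext (by exact_mod_cast h1) (by exact_mod_cast h2)

theorem gaussPt_add (p q : ℤ × ℤ) : gaussPt (p + q) = gaussPt p + gaussPt q := by
  simp only [gaussPt, Prod.fst_add, Prod.snd_add]; push_cast; ring

theorem sigmaFun_gaussPt (p : ℤ × ℤ) : sigmaFun (gaussPt p) = 0 := sigmaFun_lattice p.1 p.2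

theorem deriv_sigmaFun_gaussPt_ne_zero (p : ℤ × ℤ) : deriv sigmaFun (gaussPt p) ≠ 0 := by
  rw [← norm_pos_iff, gaussPt, norm_deriv_sigmaFun_lattice]
  exact mul_pos (norm_pos_iff.2 deriv_sigmaFun_zero_ne_zero) (Real.exp_pos _)

/-- The points at distance at least `1/2` from all Gaussian integers. -/
def farSet : Set ℂ := {z | ∀ p : ℤ × ℤ, 1 / 2 ≤ ‖z - gaussPt p‖}

theorem isClosed_farSet : IsClosed farSet := by
  simp only [farSet, Set.ofPred_forall]
  exact isClosed_iInter fun p => isClosed_le continuous_const (by fun_prop)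

theorem sigmaFun_ne_zero_of_mem_farSet {z : ℂ} (hz : z ∈ farSet) : sigmaFun z ≠ 0 := fun h => by
  obtain ⟨m, n, h⟩ := exists_int_of_sigmaFun_eq_zero h
  have := hz (m, n)
  rw [h, gaussPt, sub_self, norm_zero] at this
  norm_num at this

theorem exists_gaussPt_near (z : ℂ) : ∃ p : ℤ × ℤ,
    |(z - gaussPt p).re| ≤ 1 / 2 ∧ |(z - gaussPt p).im| ≤ 1 / 2 :=
  ⟨(round z.re, round z.im), by
    rw [Complex.sub_re, gaussPt_re]; exact abs_sub_round _, by
    rw [Complex.sub_im, gaussPt_im]; exact abs_sub_round _⟩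

/-- By double periodicity it suffices to bound `sigmaMod` below on a compact part of `farSet`, where
it is continuous and has no zeros. -/
theorem exists_sigmaMod_ge : ∃ c > 0, ∀ z ∈ farSet, c ≤ sigmaMod z := by
  have hK : IsCompact (Metric.closedBall (0 : ℂ) 1 ∩ farSet) :=
    (isCompact_closedBall 0 1).inter_right isClosed_farSet
  obtain ⟨c, hc, h⟩ := hK.exists_forall_le' (a := 0) continuous_sigmaMod.continuousOn
    fun z hz => mul_pos (norm_pos_iff.2 (sigmaFun_ne_zero_of_mem_farSet hz.2)) (Real.exp_pos _)
  refine ⟨c, hc, fun z hz => ?_⟩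
  obtain ⟨p, h1, h2⟩ := exists_gaussPt_near z
  have h3 : sigmaMod z = sigmaMod (z - gaussPt p) := by
    have := sigmaMod_add_lattice (z - gaussPt p) p.1 p.2
    rwa [← gaussPt, sub_add_cancel] at this
  rw [h3]
  refine h _ ⟨?_, fun q => ?_⟩
  · rw [mem_closedBall_zero_iff]
    linarith [Complex.norm_le_abs_re_add_abs_im (z - gaussPt p)]
  · have := hz (p + q)
    rwa [gaussPt_add, ← sub_sub] at this

/-- These are the moduli of the terms of the Jacobi theta series at `τ = i/2`. -/
theorem summable_exp_neg_int_sq :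
    Summable fun m : ℤ => Real.exp (-(Real.pi / 2 * (m : ℝ) ^ 2)) := by
  have h := ((summable_jacobiTheta₂_term_iff 0 (Complex.I / 2)).2 (by simp)).norm
  refine h.congr fun m => ?_
  rw [jacobiTheta₂_term, Complex.norm_exp, show 2 * Real.pi * Complex.I * (m : ℂ) * 0 +
    Real.pi * Complex.I * (m : ℂ) ^ 2 * (Complex.I / 2) =
    ((-(Real.pi / 2 * (m : ℝ) ^ 2) : ℝ) : ℂ) by
      push_cast; linear_combination (Real.pi / 2 * (m : ℂ) ^ 2) * Complex.I_sq, Complex.ofReal_re]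

theorem summable_inv_norm_deriv_sigmaFun :
    Summable fun p : ℤ × ℤ => ‖deriv sigmaFun (gaussPt p)‖⁻¹ := by
  have h := (summable_exp_neg_int_sq.mul_of_nonneg summable_exp_neg_int_sq
    (fun _ => Real.exp_nonneg _) (fun _ => Real.exp_nonneg _)).mul_left ‖deriv sigmaFun 0‖⁻¹
  refine h.congr fun p => ?_
  rw [gaussPt, norm_deriv_sigmaFun_lattice, mul_inv, ← Real.exp_neg, ← Real.exp_add]
  congr 2
  ring

open Classical in
/-- The quotient of two entire functions, with the simple zeros of the denominator removed. -/
theorem differentiableAt_quotient {G S : ℂ → ℂ} (hG : Differentiable ℂ G) (hS : Differentiable ℂ S)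
    {z : ℂ} (hz : S z = 0 → G z = 0 ∧ deriv S z ≠ 0) :
    DifferentiableAt ℂ (fun w => if S w = 0 then deriv G w / deriv S w else G w / S w) z := by
  by_cases h : S z = 0
  · obtain ⟨hG0, hS0⟩ := hz h
    have hdiff {f : ℂ → ℂ} (hf : Differentiable ℂ f) : Differentiable ℂ (dslope f z) :=
      differentiableOn_univ.1
        ((Complex.differentiableOn_dslope Filter.univ_mem).2 hf.differentiableOn)
    -- Near `z` each function is `w - z` times its `dslope`, and the common factor cancels.
    have hne : ∀ᶠ w in nhds z, dslope S z w ≠ 0 :=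
      (hdiff hS).continuous.continuousAt.eventually_ne (by rwa [dslope_same])
    have hq : DifferentiableAt ℂ (fun w => dslope G z w / dslope S z w) z :=
      (hdiff hG z).div (hdiff hS z) (by rwa [dslope_same])
    refine hq.congr_of_eventuallyEq ?_
    filter_upwards [hne] with w hw
    by_cases hwz : w = z
    · rw [hwz, if_pos h, dslope_same, dslope_same]
    · have e1 : S w = (w - z) * dslope S z w := by
        rw [← smul_eq_mul, sub_smul_dslope, h, sub_zero]
      have e2 : G w = (w - z) * dslope G z w := by
        rw [← smul_eq_mul, sub_smul_dslope, hG0, sub_zero]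
      have hwz' : w - z ≠ 0 := sub_ne_zero.2 hwz
      rw [if_neg (by rw [e1]; exact mul_ne_zero hwz' hw), e1, e2, mul_div_mul_left _ _ hwz']
  · refine ((hG z).div (hS z) h).congr_of_eventuallyEq ?_
    filter_upwards [hS.continuous.continuousAt.eventually_ne h] with w hw
    simp only [if_neg hw, Pi.div_apply]

/-! ### Lagrange interpolation on squares -/

/-- The open square of half side `R + 1/2` centred at the origin. -/
def square (R : ℕ) : Set ℂ :=
  Set.Ioo (-((R : ℝ) + 1 / 2)) (R + 1 / 2) ×ℂ Set.Ioo (-((R : ℝ) + 1 / 2)) (R + 1 / 2)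

theorem closure_square (R : ℕ) : closure (square R) =
    Set.Icc (-((R : ℝ) + 1 / 2)) (R + 1 / 2) ×ℂ Set.Icc (-((R : ℝ) + 1 / 2)) (R + 1 / 2) := by
  have : (-((R : ℝ) + 1 / 2)) ≠ R + 1 / 2 := by
    have : (0 : ℝ) ≤ R := by positivity
    linarith
  rw [square, Complex.closure_reProdIm, closure_Ioo this]

theorem isBounded_square (R : ℕ) : Bornology.IsBounded (square R) :=
  (Metric.isBounded_Ioo _ _).reProdIm (Metric.isBounded_Ioo _ _)

theorem abs_eq_of_mem_frontier_square {R : ℕ} {z : ℂ} (hz : z ∈ frontier (square R)) :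
    (|z.re| = R + 1 / 2 ∨ |z.im| = R + 1 / 2) := by
  have hR : (0 : ℝ) ≤ R := by positivity
  have hlt : (-((R : ℝ) + 1 / 2)) < R + 1 / 2 := by linarith
  rw [square, Complex.frontier_reProdIm, frontier_Ioo hlt] at hz
  rcases hz with h | h
  · right
    rcases h.2 with h | h
    · rw [h, abs_neg, abs_of_nonneg (by linarith)]
    · rw [h, abs_of_nonneg (by linarith)]
  · left
    rcases h.1 with h | h
    · rw [h, abs_neg, abs_of_nonneg (by linarith)]
    · rw [h, abs_of_nonneg (by linarith)]

theorem half_le_abs_sub_int {x : ℝ} {R : ℕ} (hx : |x| = R + 1 / 2) (m : ℤ) : 1 / 2 ≤ |x - m| := by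
  have key (k j : ℤ) : (1 : ℝ) / 2 ≤ |(k : ℝ) + 1 / 2 - j| := by
    rcases le_or_gt j k with h | h
    · have : (j : ℝ) ≤ k := by exact_mod_cast h
      rw [abs_of_nonneg (by linarith)]; linarith
    · have : (k : ℝ) + 1 ≤ j := by exact_mod_cast h
      rw [abs_of_nonpos (by linarith)]; linarith
  rcases (abs_eq (by positivity)).1 hx with h | h
  · rw [h]; exact_mod_cast key R m
  · rw [h, ← abs_neg]
    have := key R (-m)
    push_cast at this
    rwa [show -(-((R : ℝ) + 1 / 2) - m) = R + 1 / 2 - -(m : ℝ) by ring]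

/-- The half-integer side puts one coordinate of each boundary point midway between consecutive
integers. -/
theorem frontier_square_subset_farSet (R : ℕ) : frontier (square R) ⊆ farSet := fun z hz p => by
  rcases abs_eq_of_mem_frontier_square hz with h | h
  · refine (half_le_abs_sub_int h p.1).trans ?_
    rw [← gaussPt_re, ← Complex.sub_re]
    exact Complex.abs_re_le_norm _
  · refine (half_le_abs_sub_int h p.2).trans ?_
    rw [← gaussPt_im, ← Complex.sub_im]
    exact Complex.abs_im_le_norm _

theorem le_norm_of_mem_frontier_square {R : ℕ} {z : ℂ} (hz : z ∈ frontier (square R)) :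
    (R : ℝ) ≤ ‖z‖ := by
  rcases abs_eq_of_mem_frontier_square hz with h | h
  · linarith [Complex.abs_re_le_norm z]
  · linarith [Complex.abs_im_le_norm z]

theorem int_mem_Icc_of_mem_Icc {R : ℕ} {m : ℤ}
    (h : (m : ℝ) ∈ Set.Icc (-((R : ℝ) + 1 / 2)) (R + 1 / 2)) :
    m ∈ Finset.Icc (-(R : ℤ)) R := by
  have h1 : (m : ℝ) < ((R + 1 : ℤ) : ℝ) := by push_cast; linarith [h.2]
  have h2 : ((-(R + 1) : ℤ) : ℝ) < m := by push_cast; linarith [h.1]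
  rw [Int.cast_lt] at h1 h2
  exact Finset.mem_Icc.2 ⟨by omega, by omega⟩

/-- The Gaussian integers in the square of half side `R + 1/2`. -/
noncomputable def squareIndex (R : ℕ) : Finset (ℤ × ℤ) :=
  Finset.Icc (-(R : ℤ)) R ×ˢ Finset.Icc (-(R : ℤ)) R

/-- The error of the truncated Lagrange interpolation of `F` at the Gaussian integers. -/
noncomputable def lagrangeError (F : ℂ → ℂ) (R : ℕ) (z : ℂ) : ℂ :=
  F z - ∑ p ∈ squareIndex R, F (gaussPt p) / deriv sigmaFun (gaussPt p) *
    dslope sigmaFun (gaussPt p) z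

theorem differentiable_lagrangeError {F : ℂ → ℂ} (hF : Differentiable ℂ F) (R : ℕ) :
    Differentiable ℂ (lagrangeError F R) := by
  refine hF.sub (Differentiable.fun_sum fun p _ => ?_)
  exact (differentiableOn_univ.1 ((Complex.differentiableOn_dslope Filter.univ_mem).2
    differentiable_sigmaFun.differentiableOn)).const_mul _

theorem lagrangeError_gaussPt (F : ℂ → ℂ) {R : ℕ} {p : ℤ × ℤ} (hp : p ∈ squareIndex R) :
    lagrangeError F R (gaussPt p) = 0 := by
  rw [lagrangeError, Finset.sum_eq_single_of_mem p hp, dslope_same,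
    div_mul_cancel₀ _ (deriv_sigmaFun_gaussPt_ne_zero p), sub_self]
  intro q _ hq
  rw [dslope_of_ne _ fun h => hq (gaussPt_injective h).symm, slope_def_field, sigmaFun_gaussPt,
    sigmaFun_gaussPt, sub_self, zero_div, mul_zero]

/-- Off the lattice each term is `F(p) / σ'(p) * σ(z) / (z - p)` with `σ = sigmaFun`, and `|z - p| ≥
1/2` gives the factor `2`. The bound depends neither on `R` nor on the growth of `F`. -/
theorem norm_lagrangeError_sub_le {F : ℂ → ℂ} (hF1 : ∀ p, ‖F (gaussPt p)‖ ≤ 1) (R : ℕ) {z : ℂ}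
    (hz : z ∈ farSet) :
    ‖F z - lagrangeError F R z‖ ≤
      (2 * ∑' p : ℤ × ℤ, ‖deriv sigmaFun (gaussPt p)‖⁻¹) * ‖sigmaFun z‖ := by
  rw [lagrangeError, sub_sub_cancel]
  calc _ ≤ ∑ p ∈ squareIndex R, ‖deriv sigmaFun (gaussPt p)‖⁻¹ * (2 * ‖sigmaFun z‖) := by
        refine norm_sum_le_of_le _ fun p _ => ?_
        have hd := hz p
        have hne : z ≠ gaussPt p := fun h => by
          rw [h, sub_self, norm_zero] at hd; norm_num at hd
        rw [dslope_of_ne _ hne, slope_def_field, sigmaFun_gaussPt, sub_zero, norm_mul, norm_div,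
          norm_div]
        gcongr
        · rw [div_eq_mul_inv]
          exact mul_le_of_le_one_left (by positivity) (hF1 p)
        · rw [div_le_iff₀ (by linarith)]
          nlinarith [norm_nonneg (sigmaFun z)]
    _ = (2 * ∑ p ∈ squareIndex R, ‖deriv sigmaFun (gaussPt p)‖⁻¹) * ‖sigmaFun z‖ := by
        rw [← Finset.sum_mul]; ring
    _ ≤ _ := by
        gcongr
        exact summable_inv_norm_deriv_sigmaFun.sum_le_tsum _ fun _ _ => by positivity

/-- Maximum principle for `lagrangeError F R / sigmaFun`: the error vanishes at every zero of
`sigmaFun` in the closed square, and these zeros are simple, so the quotient is holomorphic there.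
-/
theorem norm_lagrangeError_le {F : ℂ → ℂ} (hF : Differentiable ℂ F) {R : ℕ} {C : ℝ}
    (hC : ∀ z ∈ frontier (square R), ‖lagrangeError F R z‖ ≤ C * ‖sigmaFun z‖) {z : ℂ}
    (hz : z ∈ closure (square R)) (hz0 : sigmaFun z ≠ 0) :
    ‖lagrangeError F R z‖ ≤ C * ‖sigmaFun z‖ := by
  classical
  set Q : ℂ → ℂ := fun w => if sigmaFun w = 0 then deriv (lagrangeError F R) w / deriv sigmaFun w
    else lagrangeError F R w / sigmaFun w with hQ
  have hd : DifferentiableOn ℂ Q (closure (square R)) := fun w hw => by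
    refine (differentiableAt_quotient (differentiable_lagrangeError hF R) differentiable_sigmaFun
      fun h0 => ?_).differentiableWithinAt
    obtain ⟨m, n, h⟩ := exists_int_of_sigmaFun_eq_zero h0
    have hg : w = gaussPt (m, n) := h
    rw [closure_square, Complex.mem_reProdIm, hg, gaussPt_re, gaussPt_im] at hw
    rw [hg]
    exact ⟨lagrangeError_gaussPt F (Finset.mem_product.2
      ⟨int_mem_Icc_of_mem_Icc hw.1, int_mem_Icc_of_mem_Icc hw.2⟩),
      deriv_sigmaFun_gaussPt_ne_zero _⟩
  have hle : ‖Q z‖ ≤ C := by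
    refine Complex.norm_le_of_forall_mem_frontier_norm_le (isBounded_square R) hd.diffContOnCl
      (fun w hw => ?_) hz
    have hw0 := sigmaFun_ne_zero_of_mem_farSet (frontier_square_subset_farSet R hw)
    simp only [hQ, if_neg hw0]
    rw [norm_div, div_le_iff₀ (norm_pos_iff.2 hw0)]
    exact hC w hw
  simp only [hQ, if_neg hz0] at hle
  rwa [norm_div, div_le_iff₀ (norm_pos_iff.2 hz0)] at hle

/-! ### Domination by the sigma function and Liouville's theorem -/

/-- An entire function of order two and type less than `π/2` that is bounded by one on the Gaussian
integers is dominated by `sigmaFun` off the Gaussian integers. -/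
theorem norm_le_mul_norm_sigmaFun {F : ℂ → ℂ} (hF : Differentiable ℂ F) {b : ℝ}
    (hb : b < Real.pi / 2) {C d : ℝ} (hg : ∀ z, ‖F z‖ ≤ C * Real.exp (b * ‖z‖ ^ 2 + d * ‖z‖))
    (hF1 : ∀ p, ‖F (gaussPt p)‖ ≤ 1) {z : ℂ} (hz : z ∈ farSet) :
    ‖F z‖ ≤ (4 * ∑' p : ℤ × ℤ, ‖deriv sigmaFun (gaussPt p)‖⁻¹) * ‖sigmaFun z‖ := by
  set A := ∑' p : ℤ × ℤ, ‖deriv sigmaFun (gaussPt p)‖⁻¹ with hA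
  obtain ⟨c, hc, hcle⟩ := exists_sigmaMod_ge
  have hC0 : 0 ≤ C := by
    have := (norm_nonneg _).trans (hg 0)
    exact nonneg_of_mul_nonneg_left this (Real.exp_pos _)
  -- Of `4 * A`, one half bounds the interpolation sum on the boundary and the other half the sum at
  -- `z`. The growth constants of `F` enter only through a term that vanishes as `R → ∞`.
  have hbound : ∀ᶠ R : ℕ in Filter.atTop,
      ‖F z‖ ≤ (C / c * Real.exp (-(R : ℝ)) + 4 * A) * ‖sigmaFun z‖ := by
    -- The first entry gives `(π/2 - b)‖w‖ ≥ d + 1` on the boundary, which yields the gain `e^{-R}`;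
    -- the second places `z` in the square.
    obtain ⟨R₀, hR₀⟩ := exists_nat_ge (max ((d + 1) / (Real.pi / 2 - b)) ‖z‖)
    filter_upwards [Filter.eventually_ge_atTop R₀] with R hR
    have hRR : (R₀ : ℝ) ≤ R := by exact_mod_cast hR
    have hR1 : (d + 1) / (Real.pi / 2 - b) ≤ R := (le_max_left _ _).trans (hR₀.trans hRR)
    have hR2 : ‖z‖ ≤ R := (le_max_right _ _).trans (hR₀.trans hRR)
    have hfr : ∀ w ∈ frontier (square R), ‖lagrangeError F R w‖ ≤
        (C / c * Real.exp (-(R : ℝ)) + 2 * A) * ‖sigmaFun w‖ := fun w hw => by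
      have hfar := frontier_square_subset_farSet R hw
      have hnw := le_norm_of_mem_frontier_square hw
      have h1 : b * ‖w‖ ^ 2 + d * ‖w‖ ≤ -(R : ℝ) + Real.pi / 2 * ‖w‖ ^ 2 := by
        have h2 : d + 1 ≤ ‖w‖ * (Real.pi / 2 - b) :=
          (div_le_iff₀ (by linarith)).1 (hR1.trans hnw)
        nlinarith [mul_le_mul_of_nonneg_left h2 (norm_nonneg w)]
      have h3 : ‖F w‖ ≤ C / c * Real.exp (-(R : ℝ)) * ‖sigmaFun w‖ := by
        calc ‖F w‖ ≤ C * Real.exp (-(R : ℝ) + Real.pi / 2 * ‖w‖ ^ 2) :=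
              (hg w).trans (mul_le_mul_of_nonneg_left (Real.exp_le_exp.2 h1) hC0)
          _ = C / c * Real.exp (-(R : ℝ)) * (c * Real.exp (Real.pi / 2 * ‖w‖ ^ 2)) := by
              rw [Real.exp_add]; field_simp
          _ ≤ _ := by
              rw [norm_sigmaFun]
              have := hcle w hfar
              gcongr
      have h4 := norm_lagrangeError_sub_le hF1 R hfar
      have h5 := norm_le_norm_add_norm_sub (F w) (lagrangeError F R w)
      rw [← hA] at h4
      linarith
    have hzc : z ∈ closure (square R) := by
      rw [closure_square, Complex.mem_reProdIm]
      have h1 := abs_le.1 ((Complex.abs_re_le_norm z).trans hR2)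
      have h2 := abs_le.1 ((Complex.abs_im_le_norm z).trans hR2)
      exact ⟨⟨by linarith [h1.1], by linarith [h1.2]⟩, ⟨by linarith [h2.1], by linarith [h2.2]⟩⟩
    have h6 := norm_lagrangeError_le hF hfr hzc (sigmaFun_ne_zero_of_mem_farSet hz)
    have h7 := norm_lagrangeError_sub_le hF1 R hz
    have h8 := norm_le_norm_add_norm_sub' (F z) (lagrangeError F R z)
    rw [← hA] at h7
    linarith
  have hlim : Filter.Tendsto (fun R : ℕ => (C / c * Real.exp (-(R : ℝ)) + 4 * A) * ‖sigmaFun z‖)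
      Filter.atTop (nhds ((C / c * 0 + 4 * A) * ‖sigmaFun z‖)) :=
    (((Real.tendsto_exp_neg_atTop_nhds_zero.comp tendsto_natCast_atTop_atTop).const_mul _).add_const
      _).mul_const _
  rw [mul_zero, zero_add] at hlim
  exact ge_of_tendsto hlim hbound

/-- An entire function of order two and type less than `π/2` that is bounded on the Gaussian
integers is constant. -/
theorem eq_of_bounded_on_gaussPt {F : ℂ → ℂ} (hF : Differentiable ℂ F) {b : ℝ} (hb0 : 0 ≤ b)
    (hb : b < Real.pi / 2) {C : ℝ} (hg : ∀ z, ‖F z‖ ≤ C * Real.exp (b * ‖z‖ ^ 2))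
    (hF1 : ∀ p, ‖F (gaussPt p)‖ ≤ 1) (z w : ℂ) : F z = F w := by
  set A := ∑' p : ℤ × ℤ, ‖deriv sigmaFun (gaussPt p)‖⁻¹ with hA
  obtain ⟨M, hM⟩ := (isCompact_closedBall (0 : ℂ) 1).exists_bound_of_continuousOn
    differentiable_sigmaFun.continuous.continuousOn
  have hA0 : 0 ≤ A := tsum_nonneg fun _ => by positivity
  have hC0 : 0 ≤ C := by
    have := (norm_nonneg _).trans (hg 0)
    exact nonneg_of_mul_nonneg_left this (Real.exp_pos _)
  -- Move the nearest lattice point to the origin. The translate has the same quadratic type, and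
  -- its extra linear term `2bs‖v‖` is what `d` allows for; `A` and `M` do not depend on the
  -- translation. The estimate holds on the boundary of the unit cell and passes inside, including
  -- near the lattice point, by the maximum principle.
  have hbd (u : ℂ) : ‖F u‖ ≤ 4 * A * M := by
    obtain ⟨p, h1, h2⟩ := exists_gaussPt_near u
    set s := ‖gaussPt p‖ with hs
    have hshift : Differentiable ℂ fun v => F (v + gaussPt p) := by fun_prop
    have hgs (v : ℂ) : ‖F (v + gaussPt p)‖ ≤
        (C * Real.exp (b * s ^ 2)) * Real.exp (b * ‖v‖ ^ 2 + (2 * b * s) * ‖v‖) := by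
      refine (hg _).trans ?_
      rw [mul_assoc, ← Real.exp_add]
      refine mul_le_mul_of_nonneg_left (Real.exp_le_exp.2 ?_) hC0
      have h3 : ‖v + gaussPt p‖ ^ 2 ≤ (‖v‖ + s) ^ 2 :=
        pow_le_pow_left₀ (norm_nonneg _) (norm_add_le _ _) 2
      nlinarith [mul_le_mul_of_nonneg_left h3 hb0]
    have hcell : u - gaussPt p ∈ closure (square 0) := by
      rw [closure_square, Complex.mem_reProdIm]
      have h3 := abs_le.1 h1
      have h4 := abs_le.1 h2
      norm_num
      norm_num at h3 h4
      exact ⟨h3, h4⟩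
    have h5 := Complex.norm_le_of_forall_mem_frontier_norm_le (isBounded_square 0)
      hshift.diffContOnCl (C := 4 * A * M) (fun v hv => ?_) hcell
    · rwa [sub_add_cancel] at h5
    · refine (norm_le_mul_norm_sigmaFun hshift hb hgs (fun q => ?_)
        (frontier_square_subset_farSet 0 hv)).trans ?_
      · rw [← gaussPt_add]; exact hF1 _
      · refine mul_le_mul_of_nonneg_left (hM v ?_) (by positivity)
        have h6 := frontier_subset_closure hv
        rw [closure_square, Complex.mem_reProdIm] at h6
        have h7 := abs_le.2 h6.1
        have h8 := abs_le.2 h6.2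
        rw [mem_closedBall_zero_iff]
        have h9 := Complex.norm_le_abs_re_add_abs_im v
        norm_num at h7 h8
        linarith
  refine hF.apply_eq_apply_of_bounded ?_ z w
  exact isBounded_iff_forall_norm_le.2 ⟨_, by rintro _ ⟨u, rfl⟩; exact hbd u⟩

/-! ### Conclusion in Fock space and for the Gabor transform -/

theorem exists_phase_of_norm_eq_one {a : ℝ} (ha0 : 0 < a) (ha1 : a < 1) {F : ℂ → ℂ}
    (hF : F ∈ fockSpace) (h1 : ∀ z ∈ complexSquareLattice a, ‖F z‖ = 1) :
    ∃ α : ℝ, ∀ z : ℂ, F z = Complex.exp (Complex.I * α) := by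
  obtain ⟨f, rfl⟩ := exists_bargmann_eq hF
  have hd := differentiable_bargmann f
  -- Dilation by `a` carries the Gaussian integers to the lattice and lowers the type from `π/2` to
  -- `πa²/2`; strict inequality is where `a < 1` enters.
  have hconst := eq_of_bounded_on_gaussPt (F := fun z => bargmann f (a * z)) (by fun_prop)
    (b := Real.pi / 2 * a ^ 2) (by positivity)
    (mul_lt_of_lt_one_right (by positivity) (pow_lt_one₀ ha0.le ha1 two_ne_zero)) (C := ‖f‖)
    (fun z => by
      refine (norm_bargmann_le f (a * z)).trans_eq ?_
      rw [norm_mul, Complex.norm_real, mul_pow, Real.norm_eq_abs, sq_abs, mul_assoc])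
    (fun p => (h1 _ ⟨p.1, p.2, by rw [gaussPt]; ring⟩).le)
  have h0 : ‖bargmann f 0‖ = 1 := h1 0 ⟨0, 0, by simp⟩
  refine ⟨(bargmann f 0).arg, fun z => ?_⟩
  have hz := hconst (z / a) 0
  have ha : (a : ℂ) ≠ 0 := by exact_mod_cast ha0.ne'
  simp only [mul_div_cancel₀ _ ha, mul_zero] at hz
  rw [hz]
  have := Complex.norm_mul_exp_arg_mul_I (bargmann f 0)
  rw [h0, Complex.ofReal_one, one_mul, mul_comm] at this
  exact this.symm

theorem gabor_norm_sq_eq_iff (a : ℝ) (f : L2R) :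
    (∀ p ∈ squareLattice a, ‖gabor f p‖ ^ 2 = ‖gabor gaussian p‖ ^ 2) ↔
      ∀ z ∈ complexSquareLattice a, ‖bargmann f z‖ = 1 := by
  have key (x ω : ℝ) : ‖gabor f (x, ω)‖ ^ 2 = ‖gabor gaussian (x, ω)‖ ^ 2 ↔
      ‖bargmann f (x - ω * Complex.I)‖ = 1 := by
    rw [sq_eq_sq₀ (norm_nonneg _) (norm_nonneg _), norm_gabor, norm_gabor, bargmann_gaussian,
      norm_one, mul_right_inj' (Real.exp_ne_zero _)]
  constructor
  · rintro h _ ⟨m, n, rfl⟩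
    -- The sign of `n` flips because the Bargmann transform is evaluated at `x - iω`; the lattice is
    -- invariant under this reflection.
    have := (key (a * m) (a * (-n : ℤ))).1 (h _ ⟨m, -n, rfl⟩)
    rw [← this]
    congr 2
    push_cast
    ring
  · rintro h _ ⟨m, n, rfl⟩
    rw [key, ← h _ ⟨m, -n, rfl⟩]
    congr 2
    push_cast
    ring

theorem eq_phase_smul_gaussian_iff (f : L2R) (α : ℝ) :
    f = Complex.exp (Complex.I * α) • gaussian ↔
      ∀ z : ℂ, bargmann f z = Complex.exp (Complex.I * α) := by
  have h (z : ℂ) : bargmann (Complex.exp (Complex.I * α) • gaussian) z =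
      Complex.exp (Complex.I * α) := by
    rw [bargmann_smul, bargmann_gaussian, mul_one]
  refine ⟨fun hf z => by rw [hf, h], fun hf => bargmann_injective (funext fun z => ?_)⟩
  rw [hf, h]

theorem gaussian_determined {a : ℝ} (ha0 : 0 < a) (ha1 : a < 1) (f : L2R)
    (hf : ∀ p ∈ squareLattice a, ‖gabor f p‖ ^ 2 = ‖gabor gaussian p‖ ^ 2) :
    ∃ α : ℝ, f = Complex.exp (Complex.I * α) • gaussian :=
  (exists_phase_of_norm_eq_one ha0 ha1 (bargmann_mem_fockSpace f)
    ((gabor_norm_sq_eq_iff a f).1 hf)).imp fun α => (eq_phase_smul_gaussian_iff f α).2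

theorem gaussian_notMem_counterexamples {a : ℝ} (ha0 : 0 < a) (ha1 : a < 1) :
    gaussian ∉ counterexamples (squareLattice a) := by
  rintro ⟨g, hg, hne⟩
  obtain ⟨α, rfl⟩ := gaussian_determined ha0 ha1 g fun p hp => by rw [hg p hp]
  refine hne ⟨-α, ?_⟩
  rw [smul_smul, ← Complex.exp_add, Complex.ofReal_neg, mul_neg, neg_add_cancel, Complex.exp_zero,
    one_smul]

theorem theorem3 (a : ℝ) (ha0 : 0 < a) (ha1 : a < 1) :
    -- the Gaussian is determined up to global phase by its Gabor magnitudes on `aℤ²`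
    (∀ f : L2R, (∀ p ∈ squareLattice a, ‖gabor f p‖ ^ 2 = ‖gabor gaussian p‖ ^ 2) →
      ∃ α : ℝ, f = Complex.exp (Complex.I * α) • gaussian) ∧
    -- hence it is not a counterexample, and not every signal is one
    gaussian ∉ counterexamples (squareLattice a) ∧
    counterexamples (squareLattice a) ≠ Set.univ ∧
    -- the restatement in Fock space
    (∀ F ∈ fockSpace, (∀ z ∈ complexSquareLattice a, ‖F z‖ = 1) →
      ∃ α : ℝ, ∀ z : ℂ, F z = Complex.exp (Complex.I * α)) ∧
    -- the Bargmann transform carries the hypothesis and the conclusion of the first claim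
    -- to those of the restatement, and is a bijection of `L²(ℝ)` onto Fock space
    Set.BijOn bargmann Set.univ fockSpace ∧
    (∀ f : L2R,
      ((∀ p ∈ squareLattice a, ‖gabor f p‖ ^ 2 = ‖gabor gaussian p‖ ^ 2) ↔
        ∀ z ∈ complexSquareLattice a, ‖bargmann f z‖ = 1) ∧
      ∀ α : ℝ, (f = Complex.exp (Complex.I * α) • gaussian ↔
        ∀ z : ℂ, bargmann f z = Complex.exp (Complex.I * α))) := by
  refine ⟨gaussian_determined ha0 ha1, gaussian_notMem_counterexamples ha0 ha1, fun h => ?_,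
    fun F hF h1 => exists_phase_of_norm_eq_one ha0 ha1 hF h1, bijOn_bargmann,
    fun f => ⟨gabor_norm_sq_eq_iff a f, eq_phase_smul_gaussian_iff f⟩⟩
  exact gaussian_notMem_counterexamples ha0 ha1 (h ▸ Set.mem_univ _)
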